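/- For a positive integer $n$ let $\sigma(n)$ denote the sum of the positive divisors of $n$, let $I(n)=\sigma(n)/n$, and let $\Omega(n)$ denote the number of prime factors of $n$ counted with multiplicity. An integer $N>10$ is called a friend of $10$ if $I(N)=I(10)=9/5$. Let $N$ be a friend of $10$ of the form $N=5^{2a}m^2$, where $a$ and $m$ are positive integers, and let $K$ be a real number with $\Omega(m)\le K$. Then $$N<5\cdot 6^{\left(2^{K-2a+1}-1\right)^2}.$$ -/

import Mathlib

/-- The abundancy index `I(n) = σ(n) / n`, where `σ(n)` is the sum of the positive divisors
of `n`. -/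
def abundancyIndex (n : ℕ) : ℚ :=
  (ArithmeticFunction.sigma 1 n : ℚ) / (n : ℚ)

/-- A friend of `10`: an integer `N > 10` with the same abundancy index as `10`. -/
def IsFriendOfTen (N : ℕ) : Prop :=
  10 < N ∧ abundancyIndex N = abundancyIndex 10

/-- The common abundancy index is `9 / 5`. -/
theorem abundancyIndex_ten : abundancyIndex 10 = 9 / 5 := by
  have h : ArithmeticFunction.sigma 1 10 = 18 := by decide +kernel
  rw [abundancyIndex, h]
  norm_num

/-!
Write `N = 5 ^ f * ∏ p ∈ S, p ^ e p` with `5 ∉ S`. Comparison with the abundancies of small divisors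
shows that `2` and `3` do not divide `N`, so all `p ∈ S` are at least `7`, and all exponents are
even. The equation is `5 σ(N) = 9 N`.

The size of `N` is controlled by the exponents alone. For `J ⊆ S` let `G` be the product of the
exponents in `J`, and call `J` controlled if `(p + 1) ^ e p ≤ 6 ^ G` for all `p ∈ J` and
`∏ p ∈ J, (p + 1) ^ e p ≤ 6 ^ (2 * G)`. Adding a prime `t` with `t + 1 ≤ 6 ^ G` preserves this, and
so does adding `r` primes with `p + 1 ≤ 6 ^ G * 2 ^ (r - 1)` (`IsControlled.union`). A controlled
`J ≠ S` can always be enlarged (`exists_isControlled_union`):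

* If some `t ∈ S \ J` divides `σ(p ^ e p)` with `p ∈ J`, then `t + 1 ≤ (p + 1) ^ e p ≤ 6 ^ G`.
* Otherwise the prime factors of `∏ p ∈ J, σ(p ^ e p)` are `3`, `5` or in `J`, so the abundancy of
  the remaining part is, up to the factor `1 - 5 ^ (-f - 1)`, a fraction whose denominator is a power
  `5 ^ (α + 2)`, and `4 * α ≤ G` by lifting the exponent (`closed_dichotomy`). If the fraction is
  less than `1`, then `5 ^ f ≤ 5 ^ (α + 1)`, and some `t ∈ S \ J` divides `σ(5 ^ f)`, hence is small.
  If it exceeds `1`, the abundancy of `S \ J` is bounded away from `1`; then the primes of `S \ J`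
  cannot all grow geometrically from `6 ^ G` on (`prod_div_sub_one_lt`), and some initial `r` of
  them can be added. When `J` has at most one element, a size estimate gives the same conclusion.

Hence `S` is controlled and `N ≤ 5 ^ f * 6 ^ (2 * G)` with `G = ∏ p ∈ S, e p`. Finally, `9 * 5 ^ (f - 1)`
divides `∏ p ∈ S, σ(p ^ e p)`, and the valuations of `σ(p ^ e)` at `3` and `5` are at most those of
`e + 1`. With `e * 2 ^ v₃(e + 1) * 4 ^ v₅(e + 1) ≤ 2 ^ e` this gives `4 ^ f * G ≤ 2 ^ ∑ e`
(`four_pow_mul_prod_le`), that is, `4 * G ≤ 4 ^ E` for `E = (∑ e) / 2 - f + 1 ≤ Ω(m) - 2 a + 1`,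
which leaves ample room in `6 ^ (2 ^ E - 1) ^ 2`.
-/

/-! ### The divisor sum of a prime power -/

/-- `sigmaPow p e = 1 + p + ⋯ + p ^ e`, which is `σ(p ^ e)` when `p` is prime. -/
def sigmaPow (p e : ℕ) : ℕ := ∑ i ∈ Finset.range (e + 1), p ^ i

theorem sigmaPow_succ (p e : ℕ) : sigmaPow p (e + 1) = p * sigmaPow p e + 1 := by
  rw [sigmaPow, Finset.sum_range_succ', sigmaPow, Finset.mul_sum]
  simp [pow_succ']

theorem pow_le_sigmaPow (p e : ℕ) : p ^ e ≤ sigmaPow p e :=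
  Finset.single_le_sum (f := fun i => p ^ i) (fun _ _ => Nat.zero_le _)
    (Finset.self_mem_range_succ e)

theorem pow_lt_sigmaPow {p e : ℕ} (he : e ≠ 0) : p ^ e < sigmaPow p e := by
  obtain ⟨k, rfl⟩ := Nat.exists_eq_succ_of_ne_zero he
  have := pow_le_sigmaPow p k
  rw [Nat.succ_eq_add_one, sigmaPow_succ, pow_succ']
  exact Nat.lt_succ_of_le (Nat.mul_le_mul_left p this)

theorem sigmaPow_ne_zero (p e : ℕ) : sigmaPow p e ≠ 0 := by
  cases e with
  | zero => simp [sigmaPow]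
  | succ k => rw [sigmaPow_succ]; exact Nat.succ_ne_zero _

theorem sigmaPow_mul_add_one {p : ℕ} (hp : 1 ≤ p) (e : ℕ) :
    (p - 1) * sigmaPow p e + 1 = p ^ (e + 1) := by
  obtain ⟨q, rfl⟩ := Nat.exists_eq_add_of_le' hp
  rw [Nat.add_sub_cancel]
  induction e with
  | zero => simp [sigmaPow]
  | succ k ih => rw [sigmaPow_succ, pow_succ _ (k + 1), ← ih]; ring

/-- Shifting every prime by one makes the growth of prime factors exactly multiplicative in the
exponents: a prime `t` dividing `σ(p ^ e)` satisfies `t + 1 ≤ (p + 1) ^ e`. -/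
theorem sigmaPow_add_one_le {p e : ℕ} (hp : 1 ≤ p) (he : 2 ≤ e) :
    sigmaPow p e + 1 ≤ (p + 1) ^ e := by
  induction e, he using Nat.le_induction with
  | base => simp only [sigmaPow, Finset.sum_range_succ, Finset.sum_range_zero]; nlinarith
  | succ k _ ih =>
    rw [sigmaPow_succ, pow_succ]
    have : 1 ≤ (p + 1) ^ k := Nat.one_le_pow _ _ (by omega)
    nlinarith

/-- `σ(p ^ e) / p ^ e < p / (p - 1)`. -/
theorem sigmaPow_div_lt {p : ℕ} (hp : 2 ≤ p) (e : ℕ) :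
    (sigmaPow p e : ℝ) / (p : ℝ) ^ e < (p : ℝ) / ((p : ℝ) - 1) := by
  have h := sigmaPow_mul_add_one (by omega : 1 ≤ p) e
  have h' : ((p : ℝ) - 1) * sigmaPow p e + 1 = (p : ℝ) ^ (e + 1) := by
    rw [← Nat.cast_one, ← Nat.cast_sub (by omega)]
    exact_mod_cast h
  have hp' : (2 : ℝ) ≤ p := by exact_mod_cast hp
  rw [div_lt_div_iff₀ (by positivity) (by linarith)]
  rw [pow_succ] at h'
  linarith

theorem not_dvd_sigmaPow {p e : ℕ} (hp : p.Prime) (he : e ≠ 0) : ¬ p ∣ sigmaPow p e := by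
  obtain ⟨k, rfl⟩ := Nat.exists_eq_succ_of_ne_zero he
  rw [Nat.succ_eq_add_one, sigmaPow_succ]
  intro h
  exact hp.one_lt.ne' (Nat.dvd_one.1 ((Nat.dvd_add_right (dvd_mul_right p _)).1 h))

/-- If `ℓ - 1` is coprime to the number `e + 1` of terms of `1 + p + ⋯ + p ^ e`, then `ℓ` can only
divide this sum when `p ≡ 1 (mod ℓ)`, and then lifting the exponent computes its valuation. -/
theorem padicValNat_sigmaPow_le {ℓ p e : ℕ} [hℓ : Fact ℓ.Prime] (hodd : Odd ℓ) (hp : p.Prime)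
    (hne : p ≠ ℓ) (hco : (e + 1).Coprime (ℓ - 1)) :
    padicValNat ℓ (sigmaPow p e) ≤ padicValNat ℓ (e + 1) := by
  by_cases hd : ℓ ∣ sigmaPow p e
  swap
  · rw [padicValNat.eq_zero_of_not_dvd hd]; exact Nat.zero_le _
  have h1 := sigmaPow_mul_add_one hp.one_lt.le e
  have hpl : ¬ ℓ ∣ p := fun h => hne ((Nat.prime_dvd_prime_iff_eq hℓ.out hp).1 h).symm
  have hp0 : (p : ZMod ℓ) ≠ 0 := by rwa [Ne, ZMod.natCast_eq_zero_iff]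
  have hpow : (p : ZMod ℓ) ^ (e + 1) = 1 := by
    rw [← Nat.cast_pow, ← h1, Nat.cast_add, Nat.cast_mul, (ZMod.natCast_eq_zero_iff _ _).2 hd]
    simp
  have hone : (p : ZMod ℓ) = 1 := by
    have := pow_gcd_eq_one.2 ⟨hpow, ZMod.pow_card_sub_one_eq_one hp0⟩
    rwa [hco, pow_one] at this
  have hdvd : ℓ ∣ p - 1 := by
    rw [← ZMod.natCast_eq_zero_iff, Nat.cast_sub hp.one_lt.le, hone]
    simp
  have h2 := padicValNat.pow_sub_pow hodd hp.one_lt hdvd hpl (Nat.succ_ne_zero e)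
  have h3 : p ^ (e + 1) - 1 ^ (e + 1) = (p - 1) * sigmaPow p e := by rw [← h1]; simp
  rw [Nat.succ_eq_add_one, h3,
    padicValNat.mul (Nat.sub_ne_zero_of_lt hp.one_lt) (sigmaPow_ne_zero p e)] at h2
  omega

theorem padicValNat_three_sigmaPow_le {p e : ℕ} (hp : p.Prime) (hne : p ≠ 3) (he : Even e) :
    padicValNat 3 (sigmaPow p e) ≤ padicValNat 3 (e + 1) :=
  padicValNat_sigmaPow_le (by decide) hp hne
    (Nat.coprime_two_right.2 he.add_one)

theorem padicValNat_five_sigmaPow_le {p e : ℕ} (hp : p.Prime) (hne : p ≠ 5) (he : Even e) :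
    padicValNat 5 (sigmaPow p e) ≤ padicValNat 5 (e + 1) :=
  have : Fact (Nat.Prime 5) := ⟨Nat.prime_five⟩
  padicValNat_sigmaPow_le (by decide) hp hne
    (show Nat.Coprime (e + 1) (2 ^ 2) from
      Nat.Coprime.pow_right 2 (Nat.coprime_two_right.2 he.add_one))

/-! ### Weights of the exponents -/

theorem four_mul_padicValNat_five_le (e : ℕ) : 4 * padicValNat 5 (e + 1) ≤ e := by
  have h1 : 5 ^ padicValNat 5 (e + 1) ≤ e + 1 := Nat.le_of_dvd (Nat.succ_pos e) pow_padicValNat_dvd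
  have h2 : ∀ v : ℕ, 4 * v + 1 ≤ 5 ^ v := by
    intro v
    induction v with
    | zero => simp
    | succ k ih => rw [pow_succ]; omega
  have := h2 (padicValNat 5 (e + 1))
  omega

/-- The factor `2 ^ e` with which an exponent `e` enters the bound pays for the factor `e` by which
`p ^ e` lengthens the logarithm, and for the powers of `3` and `5` that `σ(p ^ e)` supplies. -/
theorem exponent_weight_le {e : ℕ} (he : Even e) (h2 : 2 ≤ e) :
    e * 2 ^ padicValNat 3 (e + 1) * 4 ^ padicValNat 5 (e + 1) ≤ 2 ^ e := by
  have hle : 2 ^ padicValNat 3 (e + 1) * 4 ^ padicValNat 5 (e + 1) ≤ e + 1 := by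
    calc _ ≤ 3 ^ padicValNat 3 (e + 1) * 5 ^ padicValNat 5 (e + 1) :=
          Nat.mul_le_mul (Nat.pow_le_pow_left (by norm_num) _) (Nat.pow_le_pow_left (by norm_num) _)
      _ ≤ e + 1 := Nat.le_of_dvd (Nat.succ_pos e)
          (Nat.Coprime.mul_dvd_of_dvd_of_dvd (Nat.Coprime.pow _ _ (by norm_num))
            pow_padicValNat_dvd pow_padicValNat_dvd)
  rcases (by rcases he with ⟨k, rfl⟩; omega : e = 2 ∨ e = 4 ∨ 6 ≤ e) with rfl | rfl | h6
  · have h5 : padicValNat 5 3 = 0 := padicValNat.eq_zero_of_not_dvd (by norm_num)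
    have h3 : padicValNat 3 3 = 1 := padicValNat_self
    norm_num [h3, h5]
  · have : Fact (Nat.Prime 5) := ⟨Nat.prime_five⟩
    have h5 : padicValNat 5 5 = 1 := padicValNat_self
    have h3 : padicValNat 3 5 = 0 := padicValNat.eq_zero_of_not_dvd (by norm_num)
    norm_num [h3, h5]
  · have key : e * (e + 1) ≤ 2 ^ e := by
      clear hle he h2
      induction e, h6 using Nat.le_induction with
      | base => norm_num
      | succ k hk ih => rw [pow_succ]; nlinarith
    rw [mul_assoc]
    exact (Nat.mul_le_mul_left e hle).trans key

theorem pow_card_le_prod_nat {R : Finset ℕ} {e : ℕ → ℕ} {b : ℕ} (he : ∀ p ∈ R, b ≤ e p) :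
    b ^ R.card ≤ ∏ p ∈ R, e p := by
  rw [← Finset.prod_const]
  exact Finset.prod_le_prod' he

theorem sum_le_prod_of_two_le {R : Finset ℕ} {e : ℕ → ℕ} (hR : R.Nonempty)
    (he : ∀ p ∈ R, 2 ≤ e p) : ∑ p ∈ R, e p ≤ ∏ p ∈ R, e p := by
  induction hR using Finset.Nonempty.cons_induction with
  | singleton a => simp
  | cons a s ha hs ih =>
    have h1 := ih fun p hp => he p (Finset.mem_cons_of_mem hp)
    have h2 := he a (Finset.mem_cons_self a s)
    have h3 : 2 ≤ ∑ p ∈ s, e p := by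
      obtain ⟨q, hq⟩ := hs
      exact (he q (Finset.mem_cons_of_mem hq)).trans
        (Finset.single_le_sum (fun _ _ => Nat.zero_le _) hq)
    rw [Finset.sum_cons, Finset.prod_cons]
    nlinarith

theorem card_succ_mul_sum_add_four_le {R : Finset ℕ} {e : ℕ → ℕ} (hR : R.Nonempty)
    (he : ∀ p ∈ R, 2 ≤ e p) :
    (R.card + 1) * ∑ p ∈ R, e p + 4 ≤ 4 * ∏ p ∈ R, e p := by
  induction hR using Finset.Nonempty.cons_induction with
  | singleton a => have := he a (Finset.mem_singleton_self a); simp; omega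
  | cons a s ha hs ih =>
    have hs2 : ∀ p ∈ s, 2 ≤ e p := fun p hp => he p (Finset.mem_cons_of_mem hp)
    have h1 := ih hs2
    have h2 := he a (Finset.mem_cons_self a s)
    have h3 := sum_le_prod_of_two_le hs hs2
    have h4 := pow_card_le_prod_nat hs2
    have hr : ∀ r, 1 ≤ r → 2 * (r + 2) ≤ 3 * 2 ^ r := by
      intro r hr
      induction r, hr using Nat.le_induction with
      | base => norm_num
      | succ k hk ih => rw [pow_succ]; omega
    have h5 := hr s.card hs.card_pos
    rw [Finset.sum_cons, Finset.prod_cons, Finset.card_cons]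
    have h6 : 2 * (s.card + 2) ≤ 3 * ∏ p ∈ s, e p := by omega
    have h7 : 2 * (s.card + 2) * e a ≤ 3 * (∏ p ∈ s, e p) * e a := Nat.mul_le_mul_right _ h6
    have h8 : (∏ p ∈ s, e p) * 2 ≤ (∏ p ∈ s, e p) * e a := Nat.mul_le_mul_left _ h2
    nlinarith

theorem card_succ_mul_le {R : Finset ℕ} {e : ℕ → ℕ} (he : ∀ p ∈ R, 2 ≤ e p) {q : ℕ}
    (hq : q ∈ R) : (R.card + 1) * e q ≤ 2 * ∏ p ∈ R, e p := by
  have h1 : 2 ^ (R.erase q).card ≤ ∏ p ∈ R.erase q, e p :=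
    pow_card_le_prod_nat fun p hp => he p (Finset.mem_of_mem_erase hp)
  have h2 : R.card = (R.erase q).card + 1 := (Finset.card_erase_add_one hq).symm
  have h3 : (R.erase q).card + 1 ≤ 2 ^ (R.erase q).card := Nat.lt_two_pow_self
  rw [← Finset.mul_prod_erase R e hq, h2]
  have h4 : (R.erase q).card + 1 + 1 ≤ 2 * ∏ p ∈ R.erase q, e p := by omega
  nlinarith

/-! ### Sparse sets of primes have small abundancy -/

/-- If no nonempty `R ⊆ T` lies below the threshold `X * 2 ^ (#R - 1)`, then the `r`-th smallest
element of `T` is at least `X * 2 ^ (r - 1)`, and the product over `T` converges geometrically. -/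
theorem prod_div_sub_one_le {X : ℝ} (hX : 2 < X) {T : Finset ℕ} (hT : T.Nonempty)
    (h : ∀ R ⊆ T, R.Nonempty → ∃ p ∈ R, X * 2 ^ (R.card - 1) ≤ (p : ℝ)) :
    ∏ p ∈ T, (p : ℝ) / ((p : ℝ) - 1) ≤ (X / (X - 1)) ^ 2 * (1 - 2 / (X * 2 ^ T.card)) := by
  induction hr : T.card generalizing T with
  | zero => exact absurd (Finset.card_eq_zero.1 hr) hT.ne_empty
  | succ r ih =>
    obtain ⟨p, hpT, hp⟩ := h T subset_rfl hT
    rw [hr, Nat.add_sub_cancel] at hp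
    have hx : X ≤ X * 2 ^ r := le_mul_of_one_le_right (by linarith) (one_le_pow₀ (by norm_num))
    have hstep : (p : ℝ) / (p - 1) ≤ X * 2 ^ r / (X * 2 ^ r - 1) := by
      rw [div_le_div_iff₀ (by linarith) (by linarith)]
      nlinarith
    rw [← Finset.mul_prod_erase T _ hpT]
    have hcard : (T.erase p).card = r := by rw [Finset.card_erase_of_mem hpT, hr]; rfl
    rcases (T.erase p).eq_empty_or_nonempty with h0 | hne
    · have hr0 : r = 0 := by rw [← hcard, h0, Finset.card_empty]
      subst hr0
      rw [h0, Finset.prod_empty, mul_one]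
      refine hstep.trans (le_of_eq ?_)
      have h1 : X - 1 ≠ 0 := by linarith
      have h2 : X ≠ 0 := by linarith
      field_simp
      ring
    · have hih := ih hne (fun R hR => h R (hR.trans (Finset.erase_subset _ _))) hcard
      have hC : 0 ≤ (X / (X - 1)) ^ 2 := sq_nonneg _
      generalize hxx : X * 2 ^ r = x at *
      have hx1 : x - 1 ≠ 0 := by linarith
      have hx0 : x ≠ 0 := by linarith
      have hq : 0 ≤ x / (x - 1) := div_nonneg (by linarith) (by linarith)
      have hnn : 0 ≤ ∏ q ∈ T.erase p, (q : ℝ) / ((q : ℝ) - 1) := by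
        refine Finset.prod_nonneg fun q _ => ?_
        rcases Nat.eq_zero_or_pos q with rfl | hq
        · simp
        · have : (1 : ℝ) ≤ q := by exact_mod_cast hq
          exact div_nonneg (by linarith) (by linarith)
      calc _ ≤ x / (x - 1) * ((X / (X - 1)) ^ 2 * (1 - 2 / x)) :=
            mul_le_mul hstep hih hnn hq
        _ = (X / (X - 1)) ^ 2 * ((x - 2) / (x - 1)) := by field_simp
        _ ≤ (X / (X - 1)) ^ 2 * (1 - 2 / (X * 2 ^ (r + 1))) := by
            refine mul_le_mul_of_nonneg_left ?_ hC
            have : X * 2 ^ (r + 1) = 2 * x := by rw [← hxx, pow_succ]; ring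
            have h3 : 1 - 2 / (2 * x) = (x - 1) / x := by field_simp
            rw [this, h3, div_le_div_iff₀ (by linarith) (by linarith)]
            nlinarith

theorem prod_div_sub_one_lt {X : ℝ} (hX : 2 < X) {T : Finset ℕ} (hT : T.Nonempty)
    (h : ∀ R ⊆ T, R.Nonempty → ∃ p ∈ R, X * 2 ^ (R.card - 1) ≤ (p : ℝ)) :
    ∏ p ∈ T, (p : ℝ) / ((p : ℝ) - 1) < (X / (X - 1)) ^ 2 := by
  refine (prod_div_sub_one_le hX hT h).trans_lt ?_
  have h1 : 0 < (X / (X - 1)) ^ 2 := pow_pos (div_pos (by linarith) (by linarith)) 2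
  have h2 : 0 < 2 / (X * 2 ^ T.card) := by positivity
  nlinarith

/-! ### Factorization data of a friend of ten -/

/-- The factorization `5 ^ f * ∏ p ∈ S, p ^ e p` of a square with abundancy index `9 / 5` and no
prime factor below `5`. The equation `5 σ(N) = 9 N` is written out over the prime powers. -/
structure IsFriendFactorization (S : Finset ℕ) (e : ℕ → ℕ) (f : ℕ) : Prop where
  prime : ∀ p ∈ S, p.Prime
  seven_le : ∀ p ∈ S, 7 ≤ p
  even : ∀ p ∈ S, Even (e p)
  two_le : ∀ p ∈ S, 2 ≤ e p
  five_even : Even f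
  five_two_le : 2 ≤ f
  eq : 5 * sigmaPow 5 f * ∏ p ∈ S, sigmaPow p (e p) = 9 * 5 ^ f * ∏ p ∈ S, p ^ e p

/-- A set `J` of primes is controlled if its prime powers obey bounds depending only on the
product of the exponents, the primes being replaced by their successors. -/
def IsControlled (e : ℕ → ℕ) (J : Finset ℕ) : Prop :=
  (∀ p ∈ J, (p + 1) ^ e p ≤ 6 ^ ∏ q ∈ J, e q) ∧
    ∏ p ∈ J, (p + 1) ^ e p ≤ 6 ^ (2 * ∏ q ∈ J, e q)

theorem isControlled_empty (e : ℕ → ℕ) : IsControlled e ∅ := by simp [IsControlled]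

/-- Controlled sets may be enlarged by `r` primes below `6 ^ G * 2 ^ (r - 1)`, where `G` is the
product of the exponents so far. -/
theorem IsControlled.union {e : ℕ → ℕ} {J R : Finset ℕ} (hJ : IsControlled e J)
    (hdisj : Disjoint J R) (hR : R.Nonempty) (he : ∀ p ∈ J ∪ R, 2 ≤ e p)
    (hsmall : ∀ p ∈ R, p + 1 ≤ 6 ^ (∏ q ∈ J, e q) * 2 ^ (R.card - 1)) :
    IsControlled e (J ∪ R) := by
  have heR : ∀ p ∈ R, 2 ≤ e p := fun p hp => he p (Finset.mem_union_right _ hp)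
  have heJ : ∀ p ∈ J, 2 ≤ e p := fun p hp => he p (Finset.mem_union_left _ hp)
  rw [IsControlled, Finset.prod_union hdisj, Finset.prod_union hdisj]
  obtain ⟨hJ1, hJ2⟩ := hJ
  have hG : 1 ≤ ∏ q ∈ J, e q := Nat.one_le_iff_ne_zero.2
    (Finset.prod_ne_zero_iff.2 fun p hp => by have := heJ p hp; omega)
  have hE : 1 ≤ ∏ q ∈ R, e q := Nat.one_le_iff_ne_zero.2
    (Finset.prod_ne_zero_iff.2 fun p hp => by have := heR p hp; omega)
  have hS := card_succ_mul_sum_add_four_le hR heR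
  have hQ := fun q (hq : q ∈ R) => card_succ_mul_le heR hq
  set G := ∏ q ∈ J, e q
  set E := ∏ q ∈ R, e q
  set s := ∑ q ∈ R, e q
  have hr : 1 ≤ R.card := hR.card_pos
  -- The threshold is used through the square bound `Y ^ 2 ≤ 6 ^ (G * (r + 1))`.
  have hY : (6 ^ G * 2 ^ (R.card - 1)) ^ 2 ≤ 6 ^ (G * (R.card + 1)) := by
    obtain ⟨k, hk⟩ := Nat.exists_eq_add_of_le' hr
    rw [hk, Nat.add_sub_cancel, mul_pow, ← pow_mul, ← pow_mul,
      show G * (k + 1 + 1) = G * 2 + G * k by ring, pow_add, mul_comm k 2, pow_mul 2 2 k]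
    refine Nat.mul_le_mul_left _ ?_
    calc (2 ^ 2) ^ k ≤ 6 ^ k := Nat.pow_le_pow_left (by norm_num) k
      _ ≤ 6 ^ (G * k) := Nat.pow_le_pow_right (by norm_num) (Nat.le_mul_of_pos_left k hG)
  set Y := 6 ^ G * 2 ^ (R.card - 1)
  have hYpow : ∀ n, (Y ^ n) ^ 2 ≤ 6 ^ (G * (R.card + 1) * n) := fun n => by
    rw [pow_right_comm, pow_mul 6]
    exact Nat.pow_le_pow_left hY n
  constructor
  · intro p hp
    rcases Finset.mem_union.1 hp with hp | hp
    · exact (hJ1 p hp).trans (Nat.pow_le_pow_right (by norm_num) (Nat.le_mul_of_pos_right G hE))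
    · rw [← Nat.pow_le_pow_iff_left (two_ne_zero)]
      calc ((p + 1) ^ e p) ^ 2 ≤ (Y ^ e p) ^ 2 :=
            Nat.pow_le_pow_left (Nat.pow_le_pow_left (hsmall p hp) _) _
        _ ≤ 6 ^ (G * (R.card + 1) * e p) := hYpow _
        _ ≤ (6 ^ (G * E)) ^ 2 := by
          rw [← pow_mul]
          refine Nat.pow_le_pow_right (by norm_num) ?_
          have := Nat.mul_le_mul_left G (hQ p hp)
          linarith
  · rw [← Nat.pow_le_pow_iff_left (two_ne_zero), mul_pow]
    have h1 : ∏ p ∈ R, (p + 1) ^ e p ≤ Y ^ s := by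
      rw [← Finset.prod_pow_eq_pow_sum]
      exact Finset.prod_le_prod' fun p hp => Nat.pow_le_pow_left (hsmall p hp) _
    calc _ ≤ (6 ^ (2 * G)) ^ 2 * 6 ^ (G * (R.card + 1) * s) :=
          Nat.mul_le_mul (Nat.pow_le_pow_left hJ2 2) ((Nat.pow_le_pow_left h1 2).trans (hYpow _))
      _ ≤ (6 ^ (2 * (G * E))) ^ 2 := by
        rw [← pow_mul, ← pow_mul, ← pow_add]
        refine Nat.pow_le_pow_right (by norm_num) ?_
        have := Nat.mul_le_mul_left G hS
        linarith

namespace IsFriendFactorization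

variable {S : Finset ℕ} {e : ℕ → ℕ} {f : ℕ}

theorem four_mul_sigmaPow_five (f : ℕ) : 4 * sigmaPow 5 f + 1 = 5 ^ (f + 1) :=
  sigmaPow_mul_add_one (p := 5) (by norm_num) f

/-- The power of `5` in `∏ p ∈ J, σ(p ^ e p)` is at most a quarter of the product of the
exponents. -/
theorem four_mul_le_prod (h : IsFriendFactorization S e f) {J : Finset ℕ} (hJS : J ⊆ S)
    (hJ : J.Nonempty) {α : ℕ} (hα : 5 ^ α ∣ ∏ p ∈ J, sigmaPow p (e p)) :
    4 * α ≤ ∏ p ∈ J, e p := by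
  have : Fact (Nat.Prime 5) := ⟨Nat.prime_five⟩
  refine le_trans ?_ (sum_le_prod_of_two_le hJ fun p hp => h.two_le p (hJS hp))
  have h0 : ∏ p ∈ J, sigmaPow p (e p) ≠ 0 :=
    Finset.prod_ne_zero_iff.2 fun p _ => sigmaPow_ne_zero _ _
  rw [padicValNat_dvd_iff_le h0, ← Nat.factorization_def _ Nat.prime_five,
    Nat.factorization_prod fun p _ => sigmaPow_ne_zero _ _, Finsupp.finsetSum_apply] at hα
  refine (Nat.mul_le_mul_left 4 hα).trans ?_
  rw [Finset.mul_sum]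
  refine Finset.sum_le_sum fun p hp => ?_
  rw [Nat.factorization_def _ Nat.prime_five]
  have h7 := h.seven_le p (hJS hp)
  exact (Nat.mul_le_mul_left 4 (padicValNat_five_sigmaPow_le (h.prime p (hJS hp)) (by omega)
    (h.even p (hJS hp)))).trans (four_mul_padicValNat_five_le _)

/-- The quotient `∏ σ(p ^ e p) / p ^ e p` is at most `∏ p / (p - 1)`. -/
theorem abundancy_le (h : IsFriendFactorization S e f) {T : Finset ℕ} (hT : T ⊆ S) :
    ((∏ p ∈ T, sigmaPow p (e p) : ℕ) : ℝ) / (∏ p ∈ T, p ^ e p : ℕ) ≤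
      ∏ p ∈ T, (p : ℝ) / ((p : ℝ) - 1) := by
  push_cast
  rw [← Finset.prod_div_distrib]
  refine Finset.prod_le_prod (fun p _ => by positivity) fun p hp => ?_
  exact (sigmaPow_div_lt (h.prime p (hT hp)).two_le _).le

theorem prod_pow_pos (h : IsFriendFactorization S e f) {T : Finset ℕ} (hT : T ⊆ S) :
    0 < ∏ p ∈ T, p ^ e p :=
  Finset.prod_pos fun p hp => pow_pos (h.prime p (hT hp)).pos _

theorem div_sub_one_le (h : IsFriendFactorization S e f) {p : ℕ} (hp : p ∈ S) :
    (p : ℝ) / ((p : ℝ) - 1) ≤ 7 / 6 := by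
  have : (7 : ℝ) ≤ p := by exact_mod_cast h.seven_le p hp
  rw [div_le_div_iff₀ (by linarith) (by norm_num)]
  linarith

theorem five_sigmaPow_lt (f : ℕ) : 4 * sigmaPow 5 f < 5 * 5 ^ f := by
  have := four_mul_sigmaPow_five f
  rw [pow_succ] at this
  omega

theorem eq_split (h : IsFriendFactorization S e f) {J : Finset ℕ} (hJ : J ⊆ S) :
    5 * sigmaPow 5 f * (∏ p ∈ J, sigmaPow p (e p)) * (∏ p ∈ S \ J, sigmaPow p (e p)) =
      9 * 5 ^ f * (∏ p ∈ J, p ^ e p) * ∏ p ∈ S \ J, p ^ e p := by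
  have h1 := h.eq
  rw [← Finset.prod_sdiff hJ, ← Finset.prod_sdiff hJ] at h1
  linarith

theorem three_le_card (h : IsFriendFactorization S e f) : 3 ≤ S.card := by
  by_contra! hc
  have h1 := h.abundancy_le subset_rfl
  have h2 : ∏ p ∈ S, (p : ℝ) / ((p : ℝ) - 1) ≤ (7 / 6) ^ S.card := by
    rw [← Finset.prod_const]
    refine Finset.prod_le_prod (fun p hp => ?_) fun p hp => h.div_sub_one_le hp
    have : (7 : ℝ) ≤ p := by exact_mod_cast h.seven_le p hp
    exact div_nonneg (by linarith) (by linarith)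
  have h3 : ((7 : ℝ) / 6) ^ S.card ≤ (7 / 6) ^ 2 :=
    pow_le_pow_right₀ (by norm_num) (by omega)
  have hpos := h.prod_pow_pos subset_rfl
  have heq := h.eq
  have hlt := five_sigmaPow_lt f
  set A := ∏ p ∈ S, sigmaPow p (e p)
  set M := ∏ p ∈ S, p ^ e p
  have hM : (0 : ℝ) < M := by exact_mod_cast hpos
  have h4 := (h1.trans h2).trans h3
  rw [div_le_iff₀ hM] at h4
  have h5 : 36 * A ≤ 49 * M := by
    have : (36 : ℝ) * A ≤ 49 * M := by linarith
    exact_mod_cast this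
  have h6 : 0 < 5 ^ f := by positivity
  have h7 : sigmaPow 5 f * A * (4 * 36) ≤ 5 * 5 ^ f * (49 * M) := by
    calc _ = (4 * sigmaPow 5 f) * (36 * A) := by ring
      _ ≤ _ := Nat.mul_le_mul hlt.le h5
  have h8 : 0 < 5 ^ f * M := Nat.mul_pos h6 hpos
  nlinarith

/-- Abundancy of the complement of a set `J` none of whose divisor sums meets the complement: all
prime factors of `∏ p ∈ J, σ(p ^ e p)` are then `3`, `5` or in `J`, which leaves a power of `5` as
the only denominator. Either `5 ^ f` is bounded by that power, or the abundancy stays away from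
`1`. -/
theorem closed_dichotomy (h : IsFriendFactorization S e f) {J : Finset ℕ} (hJS : J ⊆ S)
    (hclosed : ∀ t ∈ S \ J, ¬ t ∣ ∏ p ∈ J, sigmaPow p (e p)) :
    ∃ α, 5 ^ α ∣ ∏ p ∈ J, sigmaPow p (e p) ∧
      (f ≤ α + 1 ∨ (5 ^ (α + 2) + 1) * ∏ p ∈ S \ J, p ^ e p <
        5 ^ (α + 2) * ∏ p ∈ S \ J, sigmaPow p (e p)) := by
  have heq := h.eq_split hJS
  have hg5 := four_mul_sigmaPow_five f
  have hA0 : ∏ p ∈ J, sigmaPow p (e p) ≠ 0 :=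
    Finset.prod_ne_zero_iff.2 fun p _ => sigmaPow_ne_zero _ _
  have hcop : (∏ p ∈ J, sigmaPow p (e p)).Coprime (∏ p ∈ S \ J, p ^ e p) :=
    Nat.Coprime.prod_right fun t ht => Nat.Coprime.pow_right _
      (((h.prime t (Finset.mem_sdiff.1 ht).1).coprime_iff_not_dvd.2 (hclosed t ht)).symm)
  have hBU : ∏ p ∈ S \ J, p ^ e p ≤ ∏ p ∈ S \ J, sigmaPow p (e p) :=
    Finset.prod_le_prod' fun p _ => pow_le_sigmaPow _ _
  have hU := h.prod_pow_pos (Finset.sdiff_subset : S \ J ⊆ S)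
  have hM := h.prod_pow_pos hJS
  set A := ∏ p ∈ J, sigmaPow p (e p)
  set M := ∏ p ∈ J, p ^ e p
  set B := ∏ p ∈ S \ J, sigmaPow p (e p)
  set U := ∏ p ∈ S \ J, p ^ e p
  obtain ⟨α, w, hw, hAw⟩ := Nat.exists_eq_pow_mul_and_not_dvd hA0 5 (by norm_num)
  refine ⟨α, ⟨w, hAw⟩, ?_⟩
  have hwA : w ∣ A := ⟨5 ^ α, by rw [hAw, mul_comm]⟩
  obtain ⟨μ, hμ⟩ : w ∣ 9 * M := by
    have h1 : w ∣ 9 * 5 ^ f * M * U := heq ▸ Dvd.dvd.mul_right (Dvd.dvd.mul_left hwA _) _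
    have h2 : w ∣ 9 * 5 ^ f * M := (hcop.coprime_dvd_left hwA).dvd_of_dvd_mul_right h1
    have h3 : w.Coprime (5 ^ f) :=
      Nat.Coprime.pow_right _ ((Nat.prime_five.coprime_iff_not_dvd.2 hw).symm)
    exact h3.dvd_of_dvd_mul_right (by rwa [mul_right_comm] at h2)
  have hw0 : 0 < w := Nat.pos_of_ne_zero (by rintro rfl; simp at hw)
  have key : 5 ^ (α + 1) * (4 * sigmaPow 5 f) * B = 5 ^ f * (4 * μ) * U := by
    refine Nat.eq_of_mul_eq_mul_left hw0 ?_
    calc w * (5 ^ (α + 1) * (4 * sigmaPow 5 f) * B)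
        = 4 * (5 * sigmaPow 5 f * (5 ^ α * w) * B) := by ring
      _ = 4 * (9 * 5 ^ f * M * U) := by rw [← hAw, heq]
      _ = 4 * (5 ^ f * (9 * M) * U) := by ring
      _ = _ := by rw [hμ]; ring
  have hB : 0 < B := hU.trans_le hBU
  have h5f : 0 < 5 ^ f := by positivity
  have hodd : Odd (5 ^ (α + 2)) := Odd.pow (by decide)
  rcases lt_or_ge (4 * μ) (5 ^ (α + 2)) with hlt | hge
  · left
    have h1 : 5 ^ (α + 1) * (4 * sigmaPow 5 f) * B ≤ 5 ^ f * (5 ^ (α + 2) - 1) * B := by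
      rw [key]
      exact Nat.mul_le_mul (Nat.mul_le_mul_left _ (by omega)) hBU
    have h2 : 5 ^ (α + 1) * (4 * sigmaPow 5 f) ≤ 5 ^ f * (5 ^ (α + 2) - 1) :=
      Nat.le_of_mul_le_mul_right h1 hB
    have h3 : 4 * sigmaPow 5 f = 5 ^ (f + 1) - 1 := by omega
    rw [h3, Nat.mul_sub, Nat.mul_sub, mul_one, mul_one, ← pow_add, ← pow_add,
      show α + 1 + (f + 1) = f + (α + 2) by ring] at h2
    have h4 : 5 ^ f ≤ 5 ^ (f + (α + 2)) := Nat.pow_le_pow_right (by norm_num) (by omega)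
    have h5 : 5 ^ f ≤ 5 ^ (α + 1) := by
      have h6 : 5 ^ (α + 1) ≤ 5 ^ (f + (α + 2)) := Nat.pow_le_pow_right (by norm_num) (by omega)
      omega
    exact (Nat.pow_le_pow_iff_right (by norm_num)).1 h5
  · right
    have h0 : 5 ^ (α + 2) + 1 ≤ 4 * μ := by
      rcases hodd with ⟨k, hk⟩
      omega
    refine Nat.lt_of_mul_lt_mul_left (a := 5 ^ f) ?_
    calc 5 ^ f * ((5 ^ (α + 2) + 1) * U) = 5 ^ f * (5 ^ (α + 2) + 1) * U := by ring
      _ ≤ 5 ^ f * (4 * μ) * U := Nat.mul_le_mul_right _ (Nat.mul_le_mul_left _ h0)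
      _ = 5 ^ (α + 1) * (4 * sigmaPow 5 f) * B := key.symm
      _ < 5 ^ (α + 1) * (5 * 5 ^ f) * B :=
        Nat.mul_lt_mul_of_pos_right
          (Nat.mul_lt_mul_of_pos_left (five_sigmaPow_lt f) (by positivity)) hB
      _ = 5 ^ f * (5 ^ (α + 2) * B) := by ring

/-- If no divisor sum over `J` meets the nonempty complement of `J`, then `σ(5 ^ f)` does: otherwise
the complementary part `n` of the number would divide `σ(n)`, although `1 < σ(n) / n < 2`. -/
theorem exists_dvd_of_closed (h : IsFriendFactorization S e f) {J : Finset ℕ} (hJS : J ⊆ S)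
    (hne : (S \ J).Nonempty) (hclosed : ∀ t ∈ S \ J, ¬ t ∣ ∏ p ∈ J, sigmaPow p (e p)) :
    ∃ t ∈ S \ J, t ∣ sigmaPow 5 f := by
  by_contra! hno
  have heq := h.eq_split hJS
  have hcop5 : (∏ p ∈ S \ J, p ^ e p).Coprime 5 :=
    Nat.Coprime.prod_left fun t ht => Nat.Coprime.pow_left _
      ((Nat.coprime_primes (h.prime t (Finset.mem_sdiff.1 ht).1) Nat.prime_five).2
        (by have := h.seven_le t (Finset.mem_sdiff.1 ht).1; omega))
  have hcopg : (∏ p ∈ S \ J, p ^ e p).Coprime (sigmaPow 5 f) :=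
    Nat.Coprime.prod_left fun t ht => Nat.Coprime.pow_left _
      ((h.prime t (Finset.mem_sdiff.1 ht).1).coprime_iff_not_dvd.2 (hno t ht))
  have hcopA : (∏ p ∈ S \ J, p ^ e p).Coprime (∏ p ∈ J, sigmaPow p (e p)) :=
    Nat.Coprime.prod_left fun t ht => Nat.Coprime.pow_left _
      ((h.prime t (Finset.mem_sdiff.1 ht).1).coprime_iff_not_dvd.2 (hclosed t ht))
  have hlt : ∏ p ∈ S \ J, p ^ e p < ∏ p ∈ S \ J, sigmaPow p (e p) :=
    Finset.prod_lt_prod_of_nonempty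
      (fun p hp => pow_pos (h.prime p (Finset.mem_sdiff.1 hp).1).pos _)
      (fun p hp => pow_lt_sigmaPow
        (by have := h.two_le p (Finset.mem_sdiff.1 hp).1; omega)) hne
  have hAM : ∏ p ∈ J, p ^ e p ≤ ∏ p ∈ J, sigmaPow p (e p) :=
    Finset.prod_le_prod' fun p _ => pow_le_sigmaPow _ _
  have hg := pow_le_sigmaPow 5 f
  have hM := h.prod_pow_pos hJS
  set A := ∏ p ∈ J, sigmaPow p (e p)
  set M := ∏ p ∈ J, p ^ e p
  set B := ∏ p ∈ S \ J, sigmaPow p (e p)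
  set U := ∏ p ∈ S \ J, p ^ e p
  have hdvd : U ∣ B :=
    ((hcop5.mul_right hcopg).mul_right hcopA).dvd_of_dvd_mul_left
      (heq ▸ dvd_mul_left U _)
  obtain ⟨c, hc⟩ := hdvd
  have hc2 : 2 ≤ c := by
    by_contra! hc1
    have : U * c ≤ U * 1 := Nat.mul_le_mul_left _ (by omega)
    omega
  have h1 : 2 * U ≤ B := by rw [hc, mul_comm 2]; exact Nat.mul_le_mul_left _ hc2
  have h2 : 0 < 5 ^ f * M * U := by
    have : 0 < U := Nat.pos_of_ne_zero (by intro h0; rw [h0] at hc hlt; simp at hc; omega)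
    positivity
  have h3 : 5 * 5 ^ f * M * (2 * U) ≤ 5 * sigmaPow 5 f * A * B :=
    Nat.mul_le_mul (Nat.mul_le_mul (Nat.mul_le_mul_left _ hg) hAM) h1
  rw [heq] at h3
  nlinarith

theorem two_pow_card_le (h : IsFriendFactorization S e f) {J : Finset ℕ} (hJS : J ⊆ S) :
    2 ^ J.card ≤ ∏ p ∈ J, e p :=
  pow_card_le_prod_nat fun p hp => h.two_le p (hJS hp)

/-! ### Enlarging controlled sets of primes -/

/-- The complement of `J` has abundancy at least `(X / (X - 1)) ^ 2`, for `X = 6 ^ G` and `G` the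
product of the exponents in `J`, unless `f` is so small that `5 ^ f` is controlled by `J`. -/
theorem sq_le_abundancy_sdiff (h : IsFriendFactorization S e f) {J : Finset ℕ} (hJS : J ⊆ S)
    (hclosed : ∀ t ∈ S \ J, ¬ t ∣ ∏ p ∈ J, sigmaPow p (e p)) :
    f + 1 ≤ ∏ p ∈ J, e p ∨
      ((6 : ℝ) ^ (∏ p ∈ J, e p) / ((6 : ℝ) ^ (∏ p ∈ J, e p) - 1)) ^ 2 ≤
        ((∏ p ∈ S \ J, sigmaPow p (e p) : ℕ) : ℝ) / (∏ p ∈ S \ J, p ^ e p : ℕ) := by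
  have hU := h.prod_pow_pos (Finset.sdiff_subset : S \ J ⊆ S)
  have hUr : (0 : ℝ) < (∏ p ∈ S \ J, p ^ e p : ℕ) := by exact_mod_cast hU
  have hcard := h.two_pow_card_le hJS
  -- Comparing sizes in `5 σ(N) = 9 N` suffices when `J` has at most one element.
  have hsize : ∀ x : ℝ, 0 < x →
      ((∏ p ∈ J, sigmaPow p (e p) : ℕ) : ℝ) ≤ x * (∏ p ∈ J, p ^ e p : ℕ) →
      36 / (25 * x) ≤
        ((∏ p ∈ S \ J, sigmaPow p (e p) : ℕ) : ℝ) / (∏ p ∈ S \ J, p ^ e p : ℕ) := by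
    intro x hx hA
    have heq := h.eq_split hJS
    have hlt := five_sigmaPow_lt f
    have hM : (0 : ℝ) < (∏ p ∈ J, p ^ e p : ℕ) := by exact_mod_cast h.prod_pow_pos hJS
    generalize ∏ p ∈ J, sigmaPow p (e p) = A at *
    generalize ∏ p ∈ J, p ^ e p = M at *
    generalize ∏ p ∈ S \ J, sigmaPow p (e p) = B at *
    generalize ∏ p ∈ S \ J, p ^ e p = U at *
    have heq' : 5 * (sigmaPow 5 f : ℝ) * A * B = 9 * 5 ^ f * M * U := by exact_mod_cast heq
    have hlt' : 4 * (sigmaPow 5 f : ℝ) ≤ 5 * 5 ^ f := by exact_mod_cast hlt.le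
    rw [div_le_div_iff₀ (by positivity) hUr]
    have hF : (0 : ℝ) < 5 ^ f * M := by positivity
    refine le_of_mul_le_mul_left ?_ hF
    calc 5 ^ f * (M : ℝ) * (36 * U) = 4 * (9 * 5 ^ f * M * U) := by ring
      _ = 5 * (4 * sigmaPow 5 f) * A * B := by rw [← heq']; ring
      _ ≤ 5 * (5 * 5 ^ f) * (x * M) * B := by gcongr
      _ = _ := by ring
  rcases (by omega : J.card = 0 ∨ J.card = 1 ∨ 2 ≤ J.card) with hc | hc | hc
  · right
    rw [Finset.card_eq_zero] at hc
    refine le_trans ?_ (hsize 1 one_pos (by simp [hc]))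
    norm_num [hc]
  · right
    have hA := h.abundancy_le hJS
    obtain ⟨p, rfl⟩ := Finset.card_eq_one.1 hc
    have hp : p ∈ S := hJS (Finset.mem_singleton_self p)
    have hM : (0 : ℝ) < (∏ p ∈ ({p} : Finset ℕ), p ^ e p : ℕ) := by
      exact_mod_cast h.prod_pow_pos hJS
    refine le_trans ?_ (hsize (7 / 6) (by norm_num) ?_)
    · rw [Finset.prod_singleton]
      have hX : (36 : ℝ) ≤ 6 ^ e p := by
        calc (36 : ℝ) = 6 ^ 2 := by norm_num
          _ ≤ 6 ^ e p := pow_le_pow_right₀ (by norm_num) (h.two_le p hp)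
      have h1 : (6 : ℝ) ^ e p / (6 ^ e p - 1) ≤ 36 / 35 := by
        rw [div_le_div_iff₀ (by linarith) (by norm_num)]
        linarith
      have h0 : 0 ≤ (6 : ℝ) ^ e p / (6 ^ e p - 1) := div_nonneg (by linarith) (by linarith)
      calc _ ≤ ((36 : ℝ) / 35) ^ 2 := pow_le_pow_left₀ h0 h1 2
        _ ≤ _ := by norm_num
    · rw [div_le_iff₀ hM] at hA
      refine hA.trans (mul_le_mul_of_nonneg_right ?_ hM.le)
      rw [Finset.prod_singleton]
      exact h.div_sub_one_le hp
  · obtain ⟨α, hα, hcase⟩ := h.closed_dichotomy hJS hclosed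
    have h4 := h.four_mul_le_prod hJS (Finset.card_pos.1 (by omega)) hα
    have hG4 : 4 ≤ ∏ p ∈ J, e p :=
      le_trans (Nat.pow_le_pow_right (by norm_num) hc : 2 ^ 2 ≤ 2 ^ J.card) hcard
    rcases hcase with hf | hlt
    · left; omega
    · right
      generalize ∏ p ∈ J, e p = G at *
      have hX : (50 : ℝ) * 5 ^ α + 2 ≤ 6 ^ G := by
        have h1 : 5 ^ α * 5 ^ 3 ≤ 5 ^ G := by
          rw [← pow_add]; exact Nat.pow_le_pow_right (by norm_num) (by omega)
        have h2 : 5 ^ G ≤ 6 ^ G := Nat.pow_le_pow_left (by norm_num) G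
        have h3 : 1 ≤ 5 ^ α := Nat.one_le_pow _ _ (by norm_num)
        have h5 : 50 * 5 ^ α + 2 ≤ 6 ^ G := by omega
        exact_mod_cast h5
      have h5 : (1 : ℝ) ≤ 5 ^ α := one_le_pow₀ (by norm_num)
      have hlt' : ((5 : ℝ) ^ (α + 2) + 1) * (∏ p ∈ S \ J, p ^ e p : ℕ) <
          5 ^ (α + 2) * (∏ p ∈ S \ J, sigmaPow p (e p) : ℕ) := by exact_mod_cast hlt
      calc _ ≤ ((5 : ℝ) ^ (α + 2) + 1) / 5 ^ (α + 2) := by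
            generalize (6 : ℝ) ^ G = X at *
            rw [div_pow, div_le_div_iff₀ (pow_pos (by linarith) 2) (by positivity), pow_add]
            generalize (5 : ℝ) ^ α = a at *
            nlinarith
        _ ≤ _ := by
            rw [div_le_div_iff₀ (by positivity) hUr]
            linarith

/-- A controlled proper subset of the primes can be enlarged. -/
theorem exists_isControlled_union (h : IsFriendFactorization S e f) {J : Finset ℕ} (hJS : J ⊆ S)
    (hne : (S \ J).Nonempty) (hJ : IsControlled e J) :
    ∃ R ⊆ S \ J, R.Nonempty ∧ IsControlled e (J ∪ R) := by
  by_contra! hno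
  have hbig : ∀ R ⊆ S \ J, R.Nonempty →
      ∃ p ∈ R, 6 ^ (∏ q ∈ J, e q) * 2 ^ (R.card - 1) < p + 1 := by
    intro R hR hRne
    by_contra! hsmall
    refine hno R hR hRne (hJ.union (Finset.disjoint_sdiff.mono_right hR) hRne ?_ hsmall)
    exact fun p hp => h.two_le p
      (Finset.union_subset hJS (hR.trans Finset.sdiff_subset) hp)
  have hlarge : ∀ t ∈ S \ J, 6 ^ (∏ q ∈ J, e q) < t + 1 := by
    intro t ht
    simpa using hbig {t} (Finset.singleton_subset_iff.2 ht) (Finset.singleton_nonempty t)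
  have hclosed : ∀ t ∈ S \ J, ¬ t ∣ ∏ p ∈ J, sigmaPow p (e p) := by
    intro t ht hdvd
    have htp := h.prime t (Finset.mem_sdiff.1 ht).1
    obtain ⟨p, hp, hdp⟩ := htp.prime.exists_mem_finset_dvd hdvd
    have h1 := Nat.le_of_dvd (Nat.pos_of_ne_zero (sigmaPow_ne_zero _ _)) hdp
    have h2 := sigmaPow_add_one_le (h.prime p (hJS hp)).one_lt.le (h.two_le p (hJS hp))
    have h3 := hJ.1 p hp
    have h4 := hlarge t ht
    omega
  rcases h.sq_le_abundancy_sdiff hJS hclosed with hf | hle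
  · obtain ⟨t, ht, hdvd⟩ := h.exists_dvd_of_closed hJS hne hclosed
    have h1 := Nat.le_of_dvd (Nat.pos_of_ne_zero (sigmaPow_ne_zero _ _)) hdvd
    have h2 := four_mul_sigmaPow_five f
    have h3 := sigmaPow_ne_zero 5 f
    have h4 := hlarge t ht
    have h5 : 5 ^ (f + 1) ≤ 6 ^ ∏ q ∈ J, e q :=
      (Nat.pow_le_pow_left (by norm_num) _).trans (Nat.pow_le_pow_right (by norm_num) hf)
    omega
  · have hG : 1 ≤ ∏ q ∈ J, e q := Nat.one_le_two_pow.trans (h.two_pow_card_le hJS)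
    have hX : (2 : ℝ) < 6 ^ ∏ q ∈ J, e q :=
      lt_of_lt_of_le (by norm_num : (2 : ℝ) < 6 ^ 1) (pow_le_pow_right₀ (by norm_num) hG)
    have hlt := prod_div_sub_one_lt hX hne fun R hR hRne => by
      obtain ⟨p, hp, hlt⟩ := hbig R hR hRne
      exact ⟨p, hp, by exact_mod_cast Nat.le_of_lt_succ hlt⟩
    exact absurd (hle.trans (h.abundancy_le Finset.sdiff_subset)) (not_le.2 hlt)

theorem isControlled (h : IsFriendFactorization S e f) : IsControlled e S := by
  have key : ∀ n, ∀ J ⊆ S, (S \ J).card = n → IsControlled e J → IsControlled e S := by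
    intro n
    induction n using Nat.strong_induction_on with
    | _ n ih =>
      intro J hJS hn hJ
      rcases (S \ J).eq_empty_or_nonempty with h0 | hne
      · rwa [← hJS.antisymm (Finset.sdiff_eq_empty_iff_subset.1 h0)]
      · obtain ⟨R, hR, hRne, hJR⟩ := h.exists_isControlled_union hJS hne hJ
        refine ih _ ?_ (J ∪ R) (Finset.union_subset hJS (hR.trans Finset.sdiff_subset)) rfl hJR
        rw [← hn]
        refine Finset.card_lt_card ⟨Finset.sdiff_subset_sdiff subset_rfl Finset.subset_union_left,
          fun hsub => ?_⟩
        obtain ⟨p, hp⟩ := hRne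
        exact (Finset.mem_sdiff.1 (hsub (hR hp))).2 (Finset.mem_union_right _ hp)
  exact key _ ∅ (Finset.empty_subset S) rfl (isControlled_empty e)

/-! ### The exponents against the number of prime factors -/

theorem five_pow_dvd (h : IsFriendFactorization S e f) :
    5 ^ (f - 1) ∣ ∏ p ∈ S, sigmaPow p (e p) := by
  have hf := h.five_two_le
  have heq := h.eq
  obtain ⟨k, rfl⟩ := Nat.exists_eq_add_of_le' (by omega : 1 ≤ f)
  have hg5 : ¬ 5 ∣ sigmaPow 5 (k + 1) := not_dvd_sigmaPow Nat.prime_five (by omega)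
  refine Nat.Coprime.dvd_of_dvd_mul_left (Nat.Coprime.pow_left _
    ((Nat.prime_five.coprime_iff_not_dvd).2 hg5)) ⟨9 * ∏ p ∈ S, p ^ e p, ?_⟩
  rw [pow_succ] at heq
  rw [Nat.add_sub_cancel]
  linarith

/-- Since `9 * 5 ^ (f - 1)` divides `∏ σ(p ^ e p)`, the exponents are large enough to absorb this
power of `15`. -/
theorem four_pow_mul_prod_le (h : IsFriendFactorization S e f) :
    4 ^ f * ∏ p ∈ S, e p ≤ 2 ^ ∑ p ∈ S, e p := by
  have : Fact (Nat.Prime 5) := ⟨Nat.prime_five⟩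
  have heq := h.eq
  have hg := four_mul_sigmaPow_five f
  have hf := h.five_two_le
  have h0 : ∏ p ∈ S, sigmaPow p (e p) ≠ 0 :=
    Finset.prod_ne_zero_iff.2 fun p _ => sigmaPow_ne_zero _ _
  have hg3 : ¬ 3 ∣ sigmaPow 5 f := by
    intro h3
    obtain ⟨k, rfl⟩ := h.five_even
    have h2 : 5 ^ (k + k + 1) % 3 = 2 := by
      rw [← two_mul, pow_succ, pow_mul, Nat.mul_mod, Nat.pow_mod]
      norm_num
    omega
  have hv3 : 2 ≤ ∑ p ∈ S, padicValNat 3 (sigmaPow p (e p)) := by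
    have hd : 3 ^ 2 ∣ ∏ p ∈ S, sigmaPow p (e p) := by
      have h1 : 3 ^ 2 ∣ 5 * sigmaPow 5 f * ∏ p ∈ S, sigmaPow p (e p) := by
        rw [heq, mul_assoc]; exact Dvd.intro _ rfl
      refine Nat.Coprime.dvd_of_dvd_mul_left (Nat.Coprime.pow_left 2 ?_) h1
      exact Nat.Coprime.mul_right (by norm_num) ((Nat.prime_three.coprime_iff_not_dvd).2 hg3)
    rw [padicValNat_dvd_iff_le h0, ← Nat.factorization_def _ Nat.prime_three,
      Nat.factorization_prod fun p _ => sigmaPow_ne_zero _ _, Finsupp.finsetSum_apply] at hd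
    simpa only [Nat.factorization_def _ Nat.prime_three] using hd
  have hv5 : f - 1 ≤ ∑ p ∈ S, padicValNat 5 (sigmaPow p (e p)) := by
    have hd := h.five_pow_dvd
    rw [padicValNat_dvd_iff_le h0, ← Nat.factorization_def _ Nat.prime_five,
      Nat.factorization_prod fun p _ => sigmaPow_ne_zero _ _, Finsupp.finsetSum_apply] at hd
    simpa only [Nat.factorization_def _ Nat.prime_five] using hd
  calc 4 ^ f * ∏ p ∈ S, e p = (∏ p ∈ S, e p) * 2 ^ 2 * 4 ^ (f - 1) := by
        obtain ⟨k, rfl⟩ := Nat.exists_eq_add_of_le' (by omega : 1 ≤ f)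
        rw [Nat.add_sub_cancel, pow_succ]; ring
    _ ≤ (∏ p ∈ S, e p) * 2 ^ (∑ p ∈ S, padicValNat 3 (sigmaPow p (e p))) *
        4 ^ ∑ p ∈ S, padicValNat 5 (sigmaPow p (e p)) := by gcongr <;> norm_num
    _ = ∏ p ∈ S, e p * 2 ^ padicValNat 3 (sigmaPow p (e p)) *
        4 ^ padicValNat 5 (sigmaPow p (e p)) := by
      rw [← Finset.prod_pow_eq_pow_sum, ← Finset.prod_pow_eq_pow_sum, Finset.prod_mul_distrib,
        Finset.prod_mul_distrib]
    _ ≤ ∏ p ∈ S, 2 ^ e p := by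
      refine Finset.prod_le_prod' fun p hp => le_trans ?_
        (exponent_weight_le (h.even p hp) (h.two_le p hp))
      have h7 := h.seven_le p hp
      have h3 := padicValNat_three_sigmaPow_le (h.prime p hp) (by omega) (h.even p hp)
      have h5 := padicValNat_five_sigmaPow_le (h.prime p hp) (by omega) (h.even p hp)
      gcongr <;> norm_num
    _ = _ := Finset.prod_pow_eq_pow_sum _ _ _

/-- The bound, with `E = Ω(m) - f + 1` where `m ^ 2` is the part of the number prime to `5`. -/
theorem lt_five_mul_pow (h : IsFriendFactorization S e f) {E : ℕ}
    (hE : 2 * (E + f) = ∑ p ∈ S, e p + 2) :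
    5 ^ f * ∏ p ∈ S, p ^ e p < 5 * 6 ^ (2 ^ E - 1) ^ 2 := by
  have hf := h.five_two_le
  have hc := h.three_le_card
  have hG8 : 8 ≤ ∏ p ∈ S, e p :=
    le_trans (Nat.pow_le_pow_right (by norm_num) hc : 2 ^ 3 ≤ 2 ^ S.card) (h.two_pow_card_le subset_rfl)
  have hfG := h.four_mul_le_prod subset_rfl (Finset.card_pos.1 (by omega)) h.five_pow_dvd
  have hGE : 4 * ∏ p ∈ S, e p ≤ (2 ^ E) ^ 2 := by
    refine Nat.le_of_mul_le_mul_left (c := 4 ^ f) ?_ (by positivity)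
    calc 4 ^ f * (4 * ∏ p ∈ S, e p) = 2 ^ 2 * (4 ^ f * ∏ p ∈ S, e p) := by ring
      _ ≤ 2 ^ 2 * 2 ^ ∑ p ∈ S, e p := Nat.mul_le_mul_left _ h.four_pow_mul_prod_le
      _ = 2 ^ (2 * (E + f)) := by rw [← pow_add, hE, add_comm]
      _ = 4 ^ f * (2 ^ E) ^ 2 := by
        rw [mul_add, pow_add, pow_mul, pow_mul, mul_comm, pow_right_comm 2 2 E]; norm_num
  have hlt : ∏ p ∈ S, p ^ e p ≤ 6 ^ (2 * ∏ p ∈ S, e p) :=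
    le_trans (Finset.prod_le_prod' fun p _ => Nat.pow_le_pow_left (Nat.le_succ p) _)
      h.isControlled.2
  generalize ∏ p ∈ S, e p = G at *
  have hexp : f - 1 + 2 * G ≤ (2 ^ E - 1) ^ 2 := by
    generalize 2 ^ E = Q at *
    have hQ : 4 ≤ Q := by nlinarith
    obtain ⟨q, rfl⟩ := Nat.exists_eq_add_of_le' hQ
    rw [show q + 4 - 1 = q + 3 by omega]
    nlinarith
  calc 5 ^ f * ∏ p ∈ S, p ^ e p = 5 * 5 ^ (f - 1) * ∏ p ∈ S, p ^ e p := by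
        rw [← pow_succ', Nat.sub_add_cancel (by omega)]
    _ < 5 * 6 ^ (f - 1) * 6 ^ (2 * G) :=
      Nat.mul_lt_mul_of_lt_of_le (Nat.mul_lt_mul_of_pos_left
        (Nat.pow_lt_pow_left (by norm_num) (by omega)) (by norm_num)) hlt (by positivity)
    _ = 5 * 6 ^ (f - 1 + 2 * G) := by rw [mul_assoc, ← pow_add]
    _ ≤ _ := Nat.mul_le_mul_left _ (Nat.pow_le_pow_right (by norm_num) hexp)

end IsFriendFactorization

/-! ### From friends of ten to factorization data -/

theorem sigma_one_mul_le {d k : ℕ} (hd : d ≠ 0) (hk : k ≠ 0) :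
    ArithmeticFunction.sigma 1 d * k ≤ ArithmeticFunction.sigma 1 (d * k) := by
  rw [ArithmeticFunction.sigma_one_apply, ArithmeticFunction.sigma_one_apply, Finset.sum_mul,
    ← Finset.sum_image (g := fun x => x * k) (f := fun x => x)
      fun x _ y _ hxy => Nat.eq_of_mul_eq_mul_right (Nat.pos_of_ne_zero hk) hxy]
  refine Finset.sum_le_sum_of_subset fun x hx => ?_
  obtain ⟨y, hy, rfl⟩ := Finset.mem_image.1 hx
  exact Nat.mem_divisors.2 ⟨Nat.mul_dvd_mul_right (Nat.dvd_of_mem_divisors hy) k,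
    mul_ne_zero hd hk⟩

theorem sigma_one_eq_prod {n : ℕ} (hn : n ≠ 0) :
    ArithmeticFunction.sigma 1 n = ∏ p ∈ n.primeFactors, sigmaPow p (n.factorization p) := by
  rw [ArithmeticFunction.sigma_one_apply, Nat.sum_divisors hn]
  rfl

theorem sq_eq_prod {x : ℕ} (hx : x ≠ 0) :
    x ^ 2 = ∏ p ∈ x.primeFactors, p ^ (2 * x.factorization p) := by
  conv_lhs => rw [← Nat.prod_factorization_pow_eq_self hx, Finsupp.prod, ← Finset.prod_pow]
  exact Finset.prod_congr rfl fun p _ => by rw [← pow_mul, mul_comm]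

theorem sigma_one_mul_prime_pow {n p e : ℕ} (hp : p.Prime) (hn : n.Coprime p) :
    ArithmeticFunction.sigma 1 (n * p ^ e) = ArithmeticFunction.sigma 1 n * sigmaPow p e := by
  rw [ArithmeticFunction.isMultiplicative_sigma.map_mul_of_coprime (Nat.Coprime.pow_right _ hn),
    ArithmeticFunction.sigma_one_apply_prime_pow hp]
  rfl

theorem IsFriendOfTen.five_mul_sigma {N : ℕ} (h : IsFriendOfTen N) :
    5 * ArithmeticFunction.sigma 1 N = 9 * N := by
  obtain ⟨h10, h⟩ := h
  have hN : (N : ℚ) ≠ 0 := by exact_mod_cast (by omega : N ≠ 0)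
  rw [abundancyIndex_ten, abundancyIndex, div_eq_div_iff hN (by norm_num)] at h
  have : (ArithmeticFunction.sigma 1 N : ℚ) * 5 = 9 * N := h
  have h' : ArithmeticFunction.sigma 1 N * 5 = 9 * N := by exact_mod_cast this
  omega

theorem IsFriendOfTen.five_mul_sigma_le {N d : ℕ} (h : IsFriendOfTen N) (hd : d ∣ N) :
    5 * ArithmeticFunction.sigma 1 d ≤ 9 * d := by
  have h9 := h.five_mul_sigma
  have h10 := h.1
  obtain ⟨k, rfl⟩ := hd
  have hd0 : d ≠ 0 := by rintro rfl; simp at h10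
  have hk0 : k ≠ 0 := by rintro rfl; simp at h10
  have h1 := sigma_one_mul_le hd0 hk0
  refine Nat.le_of_mul_le_mul_right (c := k) ?_ (Nat.pos_of_ne_zero hk0)
  linarith

theorem IsFriendOfTen.not_two_dvd {x : ℕ} (h : IsFriendOfTen (x ^ 2)) (h5 : 5 ∣ x) : ¬ 2 ∣ x := by
  intro h2
  have hd : 5 ^ 2 * 2 ^ 2 ∣ x ^ 2 := by
    rw [← mul_pow]
    exact pow_dvd_pow_of_dvd (Nat.Coprime.mul_dvd_of_dvd_of_dvd (by norm_num) h5 h2) 2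
  have h1 := h.five_mul_sigma_le hd
  rw [sigma_one_mul_prime_pow Nat.prime_two (by norm_num),
    ArithmeticFunction.sigma_one_apply_prime_pow Nat.prime_five] at h1
  simp [sigmaPow, Finset.sum_range_succ] at h1

/-- The divisor `3 ^ 4 * 5 ^ 2` is too abundant, while `3 ^ 2` exactly dividing the number brings in
the prime `13 = σ(3 ^ 2)`, and `3 ^ 2 * 5 ^ 2 * 13 ^ 2` is too abundant as well. -/
theorem IsFriendOfTen.not_three_dvd {x : ℕ} (h : IsFriendOfTen (x ^ 2)) (h5 : 5 ∣ x) :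
    ¬ 3 ∣ x := by
  intro h3
  have h9 : ¬ 9 ∣ x := by
    intro h9
    have hd : 5 ^ 2 * 3 ^ 4 ∣ x ^ 2 := by
      have : 5 * 9 ∣ x := Nat.Coprime.mul_dvd_of_dvd_of_dvd (by norm_num) h5 h9
      exact (pow_dvd_pow_of_dvd this 2)
    have h1 := h.five_mul_sigma_le hd
    rw [sigma_one_mul_prime_pow Nat.prime_three (by norm_num),
      ArithmeticFunction.sigma_one_apply_prime_pow Nat.prime_five] at h1
    simp [sigmaPow, Finset.sum_range_succ] at h1
  have hp13 : Nat.Prime 13 := by norm_num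
  have h13 : 13 ∣ x := by
    obtain ⟨y, rfl⟩ := h3
    have hy : y.Coprime 3 := ((Nat.prime_three.coprime_iff_not_dvd).2
      fun hy => h9 (Nat.mul_dvd_mul_left 3 hy)).symm
    have h1 := h.five_mul_sigma
    rw [mul_pow, mul_comm (3 ^ 2), sigma_one_mul_prime_pow Nat.prime_three
      (Nat.Coprime.pow_left 2 hy)] at h1
    have hs : sigmaPow 3 2 = 13 := by simp [sigmaPow, Finset.sum_range_succ]
    have h2 : 13 ∣ 9 * (y ^ 2 * 3 ^ 2) := by
      rw [← h1, hs, ← mul_assoc]; exact dvd_mul_left _ _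
    have h3 : 13 ∣ y ^ 2 * 3 ^ 2 := Nat.Coprime.dvd_of_dvd_mul_left (by norm_num) h2
    exact Dvd.dvd.mul_left (hp13.dvd_of_dvd_pow
      (Nat.Coprime.dvd_of_dvd_mul_right (by norm_num) h3)) 3
  have hd : 5 ^ 2 * 3 ^ 2 * 13 ^ 2 ∣ x ^ 2 := by
    rw [← mul_pow, ← mul_pow]
    exact pow_dvd_pow_of_dvd (Nat.Coprime.mul_dvd_of_dvd_of_dvd (by norm_num)
      (Nat.Coprime.mul_dvd_of_dvd_of_dvd (by norm_num) h5 h3) h13) 2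
  have h1 := h.five_mul_sigma_le hd
  rw [sigma_one_mul_prime_pow hp13 (by norm_num),
    sigma_one_mul_prime_pow Nat.prime_three (by norm_num),
    ArithmeticFunction.sigma_one_apply_prime_pow Nat.prime_five] at h1
  simp [sigmaPow, Finset.sum_range_succ] at h1

theorem IsFriendOfTen.isFriendFactorization {x : ℕ} (h : IsFriendOfTen (x ^ 2)) (h5 : 5 ∣ x) :
    IsFriendFactorization (x.primeFactors.erase 5) (fun p => 2 * x.factorization p)
      (2 * x.factorization 5) := by
  have hx : x ≠ 0 := by rintro rfl; simp [IsFriendOfTen] at h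
  have h5m : 5 ∈ x.primeFactors := Nat.mem_primeFactors.2 ⟨Nat.prime_five, h5, hx⟩
  have hpos : ∀ p ∈ x.primeFactors, 1 ≤ x.factorization p := fun p hp =>
    (Nat.prime_of_mem_primeFactors hp).factorization_pos_of_dvd hx
      (Nat.dvd_of_mem_primeFactors hp)
  refine ⟨fun p hp => Nat.prime_of_mem_primeFactors (Finset.mem_of_mem_erase hp), ?_,
    fun p _ => even_two_mul _, ?_, even_two_mul _, ?_, ?_⟩
  · intro p hp
    obtain ⟨hp5, hp⟩ := Finset.mem_erase.1 hp
    have hpp := Nat.prime_of_mem_primeFactors hp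
    have hpx := Nat.dvd_of_mem_primeFactors hp
    have h2 : p ≠ 2 := by rintro rfl; exact h.not_two_dvd h5 hpx
    have h3 : p ≠ 3 := by rintro rfl; exact h.not_three_dvd h5 hpx
    by_contra! hlt
    have := hpp.two_le
    interval_cases p <;> first | omega | (revert hpp; norm_num)
  · intro p hp
    have := hpos p (Finset.mem_of_mem_erase hp)
    omega
  · have := hpos 5 h5m
    omega
  · have h1 := h.five_mul_sigma
    rw [sigma_one_eq_prod (pow_ne_zero 2 hx), Nat.primeFactors_pow x two_ne_zero,
      Nat.factorization_pow] at h1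
    simp only [Finsupp.smul_apply, smul_eq_mul] at h1
    rw [sq_eq_prod hx, ← Finset.mul_prod_erase _ _ h5m, ← Finset.mul_prod_erase _ _ h5m] at h1
    linarith

theorem corollary1p11 (N a m : ℕ) (K : ℝ) (ha : 1 ≤ a) (hm : 1 ≤ m)
    (hN : N = 5 ^ (2 * a) * m ^ 2) (hfriend : IsFriendOfTen N)
    (hK : (ArithmeticFunction.cardFactors m : ℝ) ≤ K) :
    (N : ℝ) < 5 * (6 : ℝ) ^ (((2 : ℝ) ^ (K - 2 * (a : ℝ) + 1) - 1) ^ (2 : ℕ)) := by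
  have hm0 : m ≠ 0 := by omega
  have hx0 : 5 ^ a * m ≠ 0 := mul_ne_zero (by positivity) hm0
  have hNx : N = (5 ^ a * m) ^ 2 := by rw [hN, mul_pow, ← pow_mul, mul_comm a 2]
  have h5 : 5 ∣ 5 ^ a * m := Dvd.dvd.mul_right (dvd_pow_self 5 (by omega)) m
  have h := (hNx ▸ hfriend).isFriendFactorization h5
  have h5m : 5 ∈ (5 ^ a * m).primeFactors := Nat.mem_primeFactors.2 ⟨Nat.prime_five, h5, hx0⟩
  have hfac5 : (5 ^ a * m).factorization 5 = a + m.factorization 5 := by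
    rw [Nat.factorization_mul (by positivity) hm0, Nat.prime_five.factorization_pow]
    simp
  have hfac : ∀ p ∈ (5 ^ a * m).primeFactors.erase 5,
      (5 ^ a * m).factorization p = m.factorization p := fun p hp => by
    rw [Nat.factorization_mul (by positivity) hm0, Nat.prime_five.factorization_pow]
    simp [Finset.ne_of_mem_erase hp]
  have hNprod : N = 5 ^ (2 * (5 ^ a * m).factorization 5) *
      ∏ p ∈ (5 ^ a * m).primeFactors.erase 5, p ^ (2 * (5 ^ a * m).factorization p) := by
    rw [Finset.mul_prod_erase _ (fun p => p ^ (2 * (5 ^ a * m).factorization p)) h5m, hNx]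
    exact sq_eq_prod hx0
  set S := (5 ^ a * m).primeFactors.erase 5
  have hsum : ∑ p ∈ S, 2 * (5 ^ a * m).factorization p = 2 * ∑ p ∈ S, m.factorization p := by
    rw [Finset.mul_sum]
    exact Finset.sum_congr rfl fun p hp => by rw [hfac p hp]
  have hΩ : ∑ p ∈ S, m.factorization p ≤ ArithmeticFunction.cardFactors m := by
    rw [ArithmeticFunction.cardFactors_eq_sum_factorization, Finsupp.sum]
    refine Finset.sum_le_sum_of_ne_zero fun p _ hp => Finsupp.mem_support_iff.2 hp
  have hle : 2 * (5 ^ a * m).factorization 5 ≤ ∑ p ∈ S, m.factorization p := by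
    have h1 := h.four_pow_mul_prod_le
    have hG := h.two_pow_card_le subset_rfl
    have h2 : 4 ^ (2 * (5 ^ a * m).factorization 5) ≤ 4 ^ ∑ p ∈ S, m.factorization p := by
      rw [hsum, pow_mul 2] at h1
      exact (Nat.le_mul_of_pos_right _ (Nat.one_le_two_pow.trans hG)).trans h1
    exact (Nat.pow_le_pow_iff_right (by norm_num)).1 h2
  obtain ⟨d, hd⟩ := Nat.exists_eq_add_of_le hle
  have hbound := h.lt_five_mul_pow (E := d + 1) (by rw [hsum, hd]; ring)
  rw [← hNprod] at hbound
  have hE : ((d + 1 : ℕ) : ℝ) ≤ K - 2 * (a : ℝ) + 1 := by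
    rw [hfac5] at hd
    have h1 : d + 2 * a ≤ ArithmeticFunction.cardFactors m := by omega
    have h2 : (d : ℝ) + 2 * a ≤ ArithmeticFunction.cardFactors m := by exact_mod_cast h1
    push_cast
    linarith
  have hpow : (((2 ^ (d + 1) - 1 : ℕ)) : ℝ) ≤ (2 : ℝ) ^ (K - 2 * (a : ℝ) + 1) - 1 := by
    rw [Nat.cast_sub Nat.one_le_two_pow]
    push_cast
    rw [← Real.rpow_natCast]
    exact sub_le_sub_right (Real.rpow_le_rpow_of_exponent_le (by norm_num) hE) 1
  calc (N : ℝ) < ((5 * 6 ^ (2 ^ (d + 1) - 1) ^ 2 : ℕ) : ℝ) := by exact_mod_cast hbound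
    _ = 5 * (6 : ℝ) ^ ((((2 ^ (d + 1) - 1 : ℕ)) : ℝ) ^ 2) := by
      rw [← Nat.cast_pow, Real.rpow_natCast]
      push_cast
      rfl
    _ ≤ _ := by
      refine mul_le_mul_of_nonneg_left (Real.rpow_le_rpow_of_exponent_le (by norm_num) ?_)
        (by norm_num)
      exact pow_le_pow_left₀ (Nat.cast_nonneg _) hpow 2
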